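/- Call a family $(T_i)_{i\in I}$ of closed nondegenerate triangles in the Euclidean plane a tiling of the plane if $\bigcup_{i\in I} T_i=\mathbb{R}^2$ and no two members of the family share an interior point, that is, the interiors of $T_i$ and $T_j$ are disjoint for all $i\ne j$. There is no tiling of the plane by pairwise noncongruent triangles that all have the same area and the same perimeter. -/

import Mathlib

namespace TriangleTiling

/-- The Euclidean plane. -/
abbrev Plane : Type := EuclideanSpace ℝ (Fin 2)

/-- A nondegenerate triangle in the plane, given by its three affinely independent vertices. -/
abbrev Triangle : Type := Affine.Triangle ℝ Plane

/-- The closed triangular region spanned by the vertices. -/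
def Triangle.region (T : Triangle) : Set Plane :=
  convexHull ℝ (Set.range T.points)

/-- The area of the triangle: the Lebesgue measure of its region. -/
noncomputable def Triangle.area (T : Triangle) : ℝ :=
  (MeasureTheory.volume (Triangle.region T)).toReal

/-- The perimeter of the triangle: the sum of its three side lengths. -/
noncomputable def Triangle.perimeter (T : Triangle) : ℝ :=
  dist (T.points 0) (T.points 1) + dist (T.points 1) (T.points 2) +
    dist (T.points 2) (T.points 0)

/-- Two triangles are congruent if, for some way of matching their vertices, corresponding
vertices have equal mutual distances. -/
def Triangle.IsCongruent (S T : Triangle) : Prop :=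
  ∃ σ : Equiv.Perm (Fin 3), Congruent S.points (T.points ∘ σ)

/-- A family of triangles is a tiling of the plane if the closed triangles cover the plane
and no two members of the family share an interior point. -/
structure IsTiling {ι : Type*} (T : ι → Triangle) : Prop where
  covers : ⋃ i, Triangle.region (T i) = Set.univ
  interiors_disjoint : ∀ i j, i ≠ j →
    Disjoint (interior (Triangle.region (T i))) (interior (Triangle.region (T j)))

end TriangleTiling

/-! By Heron's formula, area, perimeter and one side determine a triangle up to congruence
(`isCongruent_of_common_sideLength`), so different tiles have no side length in common. A point of
an edge that is not a vertex lies inside sides of two tiles. These have different lengths, so an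
endpoint of one lies inside the other (`exists_points_mem_openSide`). Up to vertices, the edges are
therefore covered by sides that have a vertex of the tiling inside.

Such a vertex lies inside only one side, and the corners meeting there fill a straight angle. Each
tile has only a straight angle to give, so there are at most as many such vertices as tiles
(`IsTiling.card_sideVertex_le`). If all sides have length at most `d`, then `n` tiles have edges of
total length at most `n * d`, while the perimeters, which cover each edge at most twice, give at
least `n * p / 2`. But `sideLength_le` keeps `d` below `p / 2` by a gap that depends only on area
and perimeter.

The count is made in discs (`IsTiling.card_mul_perimeter_le`). The boundary error is harmless
because the number of tiles grows like the square of the radius. -/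

namespace TriangleTiling

open MeasureTheory Set Filter Topology Metric

/-! ### Barycentric coordinates -/

/-- The vertices of a triangle as an affine basis of the plane. -/
noncomputable def basis (T : Triangle) : AffineBasis (Fin 3) ℝ Plane :=
  ⟨T.points, T.independent, by
    rw [T.independent.affineSpan_eq_top_iff_card_eq_finrank_add_one]; simp⟩

/-- The `k`-th barycentric coordinate. -/
noncomputable def coord (T : Triangle) (k : Fin 3) : Plane →ᵃ[ℝ] ℝ := (basis T).coord k

lemma coord_points (T : Triangle) (k l : Fin 3) :
    coord T k (T.points l) = if k = l then 1 else 0 :=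
  (basis T).coord_apply k l

@[simp] lemma coord_points_self (T : Triangle) (k : Fin 3) : coord T k (T.points k) = 1 := by
  simp [coord_points]

lemma coord_points_ne (T : Triangle) {k l : Fin 3} (h : k ≠ l) : coord T k (T.points l) = 0 := by
  simp [coord_points, h]

lemma sum_coord (T : Triangle) (x : Plane) : ∑ k, coord T k x = 1 :=
  (basis T).sum_coord_apply_eq_one x

lemma coord_sum_cyclic (T : Triangle) (k : Fin 3) (x : Plane) :
    coord T k x + coord T (k + 1) x + coord T (k + 2) x = 1 := by
  rw [← sum_coord T x, Fin.sum_univ_three]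
  fin_cases k <;> simp <;> ring

lemma eq_of_coord_eq (T : Triangle) {x y : Plane} (h : ∀ k, coord T k x = coord T k y) : x = y :=
  (basis T).ext_elem h

lemma fin_three_cases (k l : Fin 3) : l = k ∨ l = k + 1 ∨ l = k + 2 := by
  revert k l; decide

lemma eq_points_of_coord (T : Triangle) {k : Fin 3} {x : Plane}
    (h1 : coord T (k + 1) x = 0) (h2 : coord T (k + 2) x = 0) : x = T.points k := by
  have h0 : coord T k x = 1 := by linarith [coord_sum_cyclic T k x]
  refine eq_of_coord_eq T fun l => ?_
  rcases fin_three_cases k l with rfl | rfl | rfl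
  · simpa using h0
  · rw [h1, coord_points_ne T ((by decide : ∀ k : Fin 3, k + 1 ≠ k) k)]
  · rw [h2, coord_points_ne T ((by decide : ∀ k : Fin 3, k + 2 ≠ k) k)]

lemma mem_region {T : Triangle} {x : Plane} : x ∈ Triangle.region T ↔ ∀ k, 0 ≤ coord T k x := by
  have := (basis T).convexHull_eq_nonneg_coord
  exact Set.ext_iff.1 this x

lemma mem_interior_region {T : Triangle} {x : Plane} :
    x ∈ interior (Triangle.region T) ↔ ∀ k, 0 < coord T k x := by
  have := (basis T).interior_convexHull
  exact Set.ext_iff.1 this x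

lemma points_mem_region (T : Triangle) (k : Fin 3) : T.points k ∈ Triangle.region T :=
  subset_convexHull ℝ _ (mem_range_self k)

lemma isCompact_region (T : Triangle) : IsCompact (Triangle.region T) :=
  (Set.finite_range _).isCompact_convexHull ℝ

lemma isClosed_region (T : Triangle) : IsClosed (Triangle.region T) :=
  (isCompact_region T).isClosed

lemma convex_region (T : Triangle) : Convex ℝ (Triangle.region T) := convex_convexHull ℝ _

lemma interior_region_nonempty (T : Triangle) : (interior (Triangle.region T)).Nonempty := by
  refine ⟨Finset.univ.centroid ℝ (basis T), mem_interior_region.2 fun k => ?_⟩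
  unfold coord
  rw [(basis T).coord_apply_centroid (Finset.mem_univ k)]
  simp

lemma volume_interior_region (T : Triangle) :
    volume (interior (Triangle.region T)) = volume (Triangle.region T) :=
  measure_interior_of_null_frontier ((convex_region T).addHaar_frontier _)

/-- The linear part of the `k`-th barycentric coordinate. -/
noncomputable def slope (T : Triangle) (k : Fin 3) : Plane →ₗ[ℝ] ℝ := (coord T k).linear

lemma coord_add (T : Triangle) (k : Fin 3) (x w : Plane) :
    coord T k (x + w) = coord T k x + slope T k w := by
  have := (coord T k).map_vadd x w
  simp only [vadd_eq_add] at this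
  rw [add_comm x w, this, add_comm]; rfl

lemma coord_eq_add_slope (T : Triangle) (k : Fin 3) (x y : Plane) :
    coord T k y = coord T k x + slope T k (y - x) := by
  rw [← coord_add]; simp

lemma slope_sum_cyclic (T : Triangle) (k : Fin 3) (w : Plane) :
    slope T k w + slope T (k + 1) w + slope T (k + 2) w = 0 := by
  have h := coord_sum_cyclic T k (0 + w)
  rw [coord_add, coord_add, coord_add] at h
  linarith [coord_sum_cyclic T k 0]

/-! ### Sides -/

/-- The closed side opposite to the vertex `k`. -/
def side (T : Triangle) (k : Fin 3) : Set Plane := {x ∈ Triangle.region T | coord T k x = 0}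

/-- The side opposite to the vertex `k`, without its endpoints. -/
def openSide (T : Triangle) (k : Fin 3) : Set Plane :=
  {x | coord T k x = 0 ∧ 0 < coord T (k + 1) x ∧ 0 < coord T (k + 2) x}

/-- The length of the side opposite to the vertex `k`. -/
noncomputable def sideLength (T : Triangle) (k : Fin 3) : ℝ :=
  dist (T.points (k + 1)) (T.points (k + 2))

lemma eq_smul_add_smul_of_coord_eq_zero (T : Triangle) {k : Fin 3} {x : Plane}
    (h : coord T k x = 0) :
    x = coord T (k + 1) x • T.points (k + 1) + coord T (k + 2) x • T.points (k + 2) := by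
  have := (basis T).linear_combination_coord_eq_self x
  conv_lhs => rw [← this]
  change ∑ i, coord T i x • T.points i = _
  rw [Fin.sum_univ_three]
  fin_cases k <;> simp_all [add_comm]

lemma side_eq_segment (T : Triangle) (k : Fin 3) :
    side T k = segment ℝ (T.points (k + 1)) (T.points (k + 2)) := by
  apply Subset.antisymm
  · rintro x ⟨hx, hk⟩
    have hx := mem_region.1 hx
    refine ⟨coord T (k + 1) x, coord T (k + 2) x, hx _, hx _, ?_,
      (eq_smul_add_smul_of_coord_eq_zero T hk).symm⟩
    linarith [coord_sum_cyclic T k x]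
  · have hc : Convex ℝ (side T k) :=
      (convex_region T).inter ((convex_singleton (0 : ℝ)).affine_preimage (coord T k))
    exact hc.segment_subset
      ⟨points_mem_region T _, coord_points_ne T ((by decide : ∀ k : Fin 3, k ≠ k + 1) k)⟩
      ⟨points_mem_region T _, coord_points_ne T ((by decide : ∀ k : Fin 3, k ≠ k + 2) k)⟩

lemma measurableSet_side (T : Triangle) (k : Fin 3) : MeasurableSet (side T k) := by
  rw [side_eq_segment, ← convexHull_pair]
  exact ((Set.toFinite _).isCompact_convexHull ℝ).isClosed.measurableSet

lemma hausdorffMeasure_side (T : Triangle) (k : Fin 3) :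
    Measure.hausdorffMeasure 1 (side T k) = ENNReal.ofReal (sideLength T k) := by
  rw [side_eq_segment, hausdorffMeasure_segment, edist_dist]; rfl

lemma openSide_subset_side (T : Triangle) (k : Fin 3) : openSide T k ⊆ side T k := by
  rintro x ⟨h0, h1, h2⟩
  refine ⟨mem_region.2 fun l => ?_, h0⟩
  rcases fin_three_cases k l with rfl | rfl | rfl
  exacts [h0.ge, h1.le, h2.le]

/-- A point of a triangle is interior, or inside a side, or a vertex. -/
lemma region_cases {T : Triangle} {x : Plane} (hx : x ∈ Triangle.region T) :
    x ∈ interior (Triangle.region T) ∨ (∃ k, x ∈ openSide T k) ∨ ∃ k, x = T.points k := by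
  have h := mem_region.1 hx
  by_cases hI : ∀ k, 0 < coord T k x
  · exact Or.inl (mem_interior_region.2 hI)
  right
  push Not at hI
  obtain ⟨k, hk⟩ := hI
  have hk : coord T k x = 0 := le_antisymm hk (h k)
  rcases (h (k + 1)).eq_or_lt with h1 | h1
  · refine Or.inr ⟨k + 2, eq_points_of_coord T ?_ ?_⟩
    · rwa [add_assoc, show (2 + 1 : Fin 3) = 0 from rfl, add_zero]
    · rw [add_assoc, show (2 + 2 : Fin 3) = 1 from rfl, ← h1]
  rcases (h (k + 2)).eq_or_lt with h2 | h2
  · refine Or.inr ⟨k + 1, eq_points_of_coord T ?_ ?_⟩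
    · rw [add_assoc, show (1 + 1 : Fin 3) = 2 from rfl, ← h2]
    · rwa [add_assoc, show (1 + 2 : Fin 3) = 0 from rfl, add_zero]
  exact Or.inl ⟨k, hk, h1, h2⟩

lemma openSide_unique {T : Triangle} {k l : Fin 3} {x : Plane} (hk : x ∈ openSide T k)
    (hl : x ∈ openSide T l) : l = k := by
  rcases fin_three_cases k l with rfl | rfl | rfl
  · rfl
  · exact absurd hl.1 hk.2.1.ne'
  · exact absurd hl.1 hk.2.2.ne'

lemma points_notMem_openSide (T : Triangle) (k l : Fin 3) : T.points l ∉ openSide T k := by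
  rintro ⟨h0, h1, h2⟩
  rw [coord_points] at h0 h1 h2
  revert h0 h1 h2
  fin_cases k <;> fin_cases l <;> simp

lemma mem_openSide_of_mem_side {T : Triangle} {k : Fin 3} {x : Plane} (hx : x ∈ side T k)
    (hv : ∀ l, x ≠ T.points l) : x ∈ openSide T k := by
  rcases region_cases hx.1 with h | ⟨l, h⟩ | ⟨l, h⟩
  · exact absurd hx.2 (mem_interior_region.1 h k).ne'
  · have hk := hx.2
    rcases fin_three_cases l k with rfl | rfl | rfl
    · exact h
    · exact absurd hk h.2.1.ne'
    · exact absurd hk h.2.2.ne'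
  · exact absurd h (hv l)

/-! ### Area, perimeter and side lengths -/

lemma perimeter_eq (T : Triangle) (k : Fin 3) :
    Triangle.perimeter T = sideLength T k + sideLength T (k + 1) + sideLength T (k + 2) := by
  unfold Triangle.perimeter sideLength
  fin_cases k <;> simp <;> ring

lemma sideLength_pos (T : Triangle) (k : Fin 3) : 0 < sideLength T k := by
  refine dist_pos.2 fun h => ?_
  have : k + 1 ≠ k + 2 := (by decide : ∀ k : Fin 3, k + 1 ≠ k + 2) k
  exact this (T.independent.injective h)

/-- Twice the signed area. -/
noncomputable def cross (T : Triangle) : ℝ :=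
  (T.points 1 0 - T.points 0 0) * (T.points 2 1 - T.points 0 1) -
    (T.points 2 0 - T.points 0 0) * (T.points 1 1 - T.points 0 1)

lemma dist_sq (x y : Plane) : dist x y ^ 2 = (x 0 - y 0) ^ 2 + (x 1 - y 1) ^ 2 := by
  rw [EuclideanSpace.dist_eq, Real.sq_sqrt (by positivity), Fin.sum_univ_two, Real.dist_eq,
    Real.dist_eq, sq_abs, sq_abs]

/-- Heron's formula for the cross product. -/
lemma heron (T : Triangle) (k : Fin 3) :
    4 * cross T ^ 2 = ((sideLength T (k + 1) + sideLength T (k + 2)) ^ 2 - sideLength T k ^ 2) *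
      (sideLength T k ^ 2 - (sideLength T (k + 1) - sideLength T (k + 2)) ^ 2) := by
  have key : ∀ a b c : ℝ, ((b + c) ^ 2 - a ^ 2) * (a ^ 2 - (b - c) ^ 2) =
      2 * (a ^ 2 * b ^ 2 + b ^ 2 * c ^ 2 + c ^ 2 * a ^ 2) -
        ((a ^ 2) ^ 2 + (b ^ 2) ^ 2 + (c ^ 2) ^ 2) := fun a b c => by ring
  rw [key]
  unfold sideLength cross
  simp only [dist_sq]
  fin_cases k <;> simp <;> ring

/-- The reference triangle spanned by the origin and the standard basis. -/
noncomputable def stdRegion : Set Plane := convexHull ℝ (range ![0, !₂[1, 0], !₂[0, 1]])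

-- The region is an affine image of `stdRegion` under a map of determinant `cross T`. Only
-- proportionality matters later, so the volume of `stdRegion` is never computed.
open scoped Pointwise in
lemma area_eq (T : Triangle) : Triangle.area T = |cross T| * (volume stdRegion).toReal := by
  let b := (EuclideanSpace.basisFun (Fin 2) ℝ).toBasis
  let M : Matrix (Fin 2) (Fin 2) ℝ :=
    !![T.points 1 0 - T.points 0 0, T.points 2 0 - T.points 0 0;
      T.points 1 1 - T.points 0 1, T.points 2 1 - T.points 0 1]
  let f : Plane →ₗ[ℝ] Plane := Matrix.toLin b b M
  have hf : ∀ x : Plane, f x = !₂[M 0 0 * x 0 + M 0 1 * x 1, M 1 0 * x 0 + M 1 1 * x 1] := by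
    intro x
    ext i
    simp only [f, Matrix.toLin_apply, b]
    fin_cases i <;> simp [Matrix.mulVec, dotProduct, Fin.sum_univ_two]
  have hdet : LinearMap.det f = cross T := by
    simp only [f, LinearMap.det_toLin, M, Matrix.det_fin_two_of, cross]
  have himg : Triangle.region T = (T.points 0 + ·) '' (f '' stdRegion) := by
    have h1 : f '' stdRegion = convexHull ℝ (f '' range ![0, !₂[1, 0], !₂[0, 1]]) :=
      f.isLinear.image_convexHull _
    have h2 := (convexHull_vadd (𝕜 := ℝ) (T.points 0) (f '' range ![0, !₂[1, 0], !₂[0, 1]]))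
    rw [h1]
    change _ = T.points 0 +ᵥ (convexHull ℝ _ : Set Plane)
    rw [← h2, ← Set.range_comp]
    change _ = convexHull ℝ ((T.points 0 + ·) '' _)
    rw [← Set.range_comp]
    unfold Triangle.region
    congr 2
    funext k
    ext i
    fin_cases k <;> fin_cases i <;> simp [hf, M]
  unfold Triangle.area
  rw [himg, image_add_left, measure_preimage_add, Measure.addHaar_image_linearMap, hdet,
    ENNReal.toReal_mul, ENNReal.toReal_ofReal (abs_nonneg _)]

lemma volume_region_ne_top (T : Triangle) : volume (Triangle.region T) ≠ ⊤ :=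
  (isCompact_region T).measure_lt_top.ne

lemma area_pos (T : Triangle) : 0 < Triangle.area T := by
  refine ENNReal.toReal_pos ?_ (volume_region_ne_top T)
  rw [← volume_interior_region]
  exact (isOpen_interior.measure_pos _ (interior_region_nonempty T)).ne'

lemma cross_sq_pos (T : Triangle) : 0 < cross T ^ 2 := by
  have h := area_pos T
  rw [area_eq] at h
  have : cross T ≠ 0 := by rintro h0; simp [h0] at h
  positivity

lemma cross_sq_eq_of_area_eq {S T : Triangle} (h : Triangle.area S = Triangle.area T) :
    cross S ^ 2 = cross T ^ 2 := by
  have hS := area_pos S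
  rw [area_eq] at h hS
  rw [area_eq] at h
  have hne : (volume stdRegion).toReal ≠ 0 := by rintro h0; simp [h0] at hS
  exact (sq_eq_sq_iff_abs_eq_abs _ _).2 (mul_right_cancel₀ hne h)

lemma isCongruent_of_sideLength_eq {S T : Triangle} (σ : Equiv.Perm (Fin 3))
    (h : ∀ k, sideLength S k = sideLength T (σ k)) : Triangle.IsCongruent S T := by
  -- Every permutation of three indices is a rotation or a reflection of the cycle, so it respects
  -- opposite sides.
  have hσ : ∀ σ : Equiv.Perm (Fin 3), ∀ k, (σ (k + 1) = σ k + 1 ∧ σ (k + 2) = σ k + 2) ∨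
      (σ (k + 1) = σ k + 2 ∧ σ (k + 2) = σ k + 1) := by decide
  have key : ∀ k, dist (S.points (k + 1)) (S.points (k + 2)) =
      dist (T.points (σ (k + 1))) (T.points (σ (k + 2))) := by
    intro k
    have hk := h k
    unfold sideLength at hk
    rcases hσ σ k with ⟨h1, h2⟩ | ⟨h1, h2⟩
    · rw [hk, h1, h2]
    · rw [hk, h1, h2, dist_comm]
  have h0 := key 0
  have h1 := key 1
  have h2 := key 2
  simp only [Fin.isValue, zero_add, Fin.reduceAdd] at h0 h1 h2
  refine ⟨σ, fun i j => ?_⟩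
  rw [edist_dist, edist_dist]
  congr 1
  fin_cases i <;> fin_cases j <;> simp only [Function.comp, Fin.zero_eta, Fin.mk_one,
    Fin.reduceFinMk, dist_self] <;> first | assumption | (rw [dist_comm, dist_comm (T.points _)]; assumption)

/-- Triangles with equal areas, equal perimeters and a pair of equal sides are congruent. -/
lemma isCongruent_of_common_sideLength {S T : Triangle} (hA : Triangle.area S = Triangle.area T)
    (hP : Triangle.perimeter S = Triangle.perimeter T) {k l : Fin 3}
    (h : sideLength S k = sideLength T l) : Triangle.IsCongruent S T := by
  have hS := heron S k
  have hT := heron T l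
  have hc := cross_sq_eq_of_area_eq hA
  have hpos := cross_sq_pos S
  rw [perimeter_eq S k, perimeter_eq T l, h] at hP
  rw [h] at hS
  have hsum : sideLength S (k + 1) + sideLength S (k + 2) =
      sideLength T (l + 1) + sideLength T (l + 2) := by linarith
  rw [hc, hT, hsum] at hS
  -- The factor divides `4 * cross T ^ 2 > 0`. Cancelling it leaves the square of the difference of
  -- the other two sides, whose sum is already known.
  have hne : (sideLength T (l + 1) + sideLength T (l + 2)) ^ 2 - sideLength T l ^ 2 ≠ 0 := by
    intro h0
    rw [h0, zero_mul] at hT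
    linarith
  have hd := mul_left_cancel₀ hne hS
  have hd : (sideLength S (k + 1) - sideLength S (k + 2)) ^ 2 =
      (sideLength T (l + 1) - sideLength T (l + 2)) ^ 2 := by linarith
  -- The sign decides whether the sides match by the rotation `m ↦ m + (l - k)` or the reflection `m
  -- ↦ k + l - m`.
  rcases sq_eq_sq_iff_eq_or_eq_neg.1 hd with hd | hd
  · refine isCongruent_of_sideLength_eq (Equiv.addRight (l - k)) fun m => ?_
    have e0 : k + (l - k) = l := by abel
    have e1 : k + 1 + (l - k) = l + 1 := by abel
    have e2 : k + 2 + (l - k) = l + 2 := by abel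
    rcases fin_three_cases k m with rfl | rfl | rfl
    · rw [Equiv.coe_addRight]; beta_reduce; rw [e0, h]
    · rw [Equiv.coe_addRight]; beta_reduce; rw [e1]; linarith
    · rw [Equiv.coe_addRight]; beta_reduce; rw [e2]; linarith
  · refine isCongruent_of_sideLength_eq (Equiv.subLeft (k + l)) fun m => ?_
    have e0 : k + l - k = l := by abel
    have e1 : k + l - (k + 1) = l + 2 := (by decide : ∀ k l : Fin 3, k + l - (k + 1) = l + 2) k l
    have e2 : k + l - (k + 2) = l + 1 := (by decide : ∀ k l : Fin 3, k + l - (k + 2) = l + 1) k l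
    rcases fin_three_cases k m with rfl | rfl | rfl
    · rw [Equiv.subLeft_apply, e0, h]
    · rw [Equiv.subLeft_apply, e1]; linarith
    · rw [Equiv.subLeft_apply, e2]; linarith

/-- Every side is shorter than half the perimeter, with a gap controlled by area and perimeter. -/
lemma sideLength_le (T : Triangle) (k : Fin 3) :
    sideLength T k ≤ Triangle.perimeter T / 2 - 2 * cross T ^ 2 / Triangle.perimeter T ^ 3 := by
  have hh := heron T k
  have hp := perimeter_eq T k
  have a0 := sideLength_pos T k
  have b0 := sideLength_pos T (k + 1)
  have c0 := sideLength_pos T (k + 2)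
  have tri : sideLength T k ≤ sideLength T (k + 1) + sideLength T (k + 2) := by
    have := dist_triangle (T.points (k + 1)) (T.points k) (T.points (k + 2))
    have e1 : k + 1 + 1 = k + 2 := (by decide : ∀ k : Fin 3, k + 1 + 1 = k + 2) k
    have e2 : k + 1 + 2 = k := (by decide : ∀ k : Fin 3, k + 1 + 2 = k) k
    have e3 : k + 2 + 1 = k := (by decide : ∀ k : Fin 3, k + 2 + 1 = k) k
    have e4 : k + 2 + 2 = k + 1 := (by decide : ∀ k : Fin 3, k + 2 + 2 = k + 1) k
    unfold sideLength
    rw [e1, e2, e3, e4, dist_comm (T.points (k + 2)) (T.points k),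
      dist_comm (T.points k) (T.points (k + 1))]
    linarith
  generalize sideLength T k = a at *
  generalize sideLength T (k + 1) = b at *
  generalize sideLength T (k + 2) = c at *
  generalize Triangle.perimeter T = p at *
  have hp0 : 0 < p := by linarith
  -- Heron's first factor is `(p - 2 * a) * p`, and the second is at most `p ^ 2`.
  have h1 : 4 * cross T ^ 2 ≤ (p - 2 * a) * p ^ 3 := by
    have e : (b + c) ^ 2 - a ^ 2 = (p - 2 * a) * p := by rw [hp]; ring
    rw [hh, e, mul_assoc]
    have : a ^ 2 - (b - c) ^ 2 ≤ p ^ 2 := by nlinarith [sq_nonneg (b - c)]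
    calc (p - 2 * a) * (p * (a ^ 2 - (b - c) ^ 2)) ≤ (p - 2 * a) * (p * p ^ 2) := by
          apply mul_le_mul_of_nonneg_left _ (by linarith)
          exact mul_le_mul_of_nonneg_left this hp0.le
      _ = _ := by ring
  have h2 : 2 * cross T ^ 2 / p ^ 3 ≤ (p - 2 * a) / 2 := by
    rw [div_le_iff₀ (by positivity)]; linarith
  linarith

lemma sideLength_le_perimeter (T : Triangle) (k : Fin 3) :
    sideLength T k ≤ Triangle.perimeter T := by
  linarith [perimeter_eq T k, sideLength_pos T (k + 1), sideLength_pos T (k + 2)]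

lemma dist_le_perimeter {T : Triangle} {x y : Plane} (hx : x ∈ Triangle.region T)
    (hy : y ∈ Triangle.region T) : dist x y ≤ Triangle.perimeter T := by
  obtain ⟨x', ⟨i, rfl⟩, y', ⟨j, rfl⟩, h⟩ := convexHull_exists_dist_ge2 hx hy
  refine h.trans ?_
  have h0 := sideLength_le_perimeter T 0
  have h1 := sideLength_le_perimeter T 1
  have h2 := sideLength_le_perimeter T 2
  have h3 : 0 ≤ Triangle.perimeter T := (sideLength_pos T 0).le.trans h0
  simp only [sideLength, Fin.isValue, zero_add, Fin.reduceAdd] at h0 h1 h2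
  fin_cases i <;> fin_cases j <;> simp only [Fin.zero_eta, Fin.mk_one, Fin.reduceFinMk,
    dist_self] <;> first | assumption | (rw [dist_comm]; assumption)

/-! ### Cones of inward directions -/

/-- The directions pointing from `v` into the interior of the triangle. -/
def innerCone (T : Triangle) (v : Plane) : Set Plane :=
  {w | ∀ l, coord T l v = 0 → 0 < slope T l w}

lemma continuous_slope (T : Triangle) (k : Fin 3) : Continuous (slope T k) :=
  (slope T k).continuous_of_finiteDimensional

lemma isOpen_innerCone (T : Triangle) (v : Plane) : IsOpen (innerCone T v) := by
  simp only [innerCone, ofPred_forall]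
  exact isOpen_iInter_of_finite fun l => isOpen_iInter_of_finite fun _ =>
    isOpen_lt continuous_const (continuous_slope T l)

lemma innerCone_nonempty (T : Triangle) (v : Plane) : (innerCone T v).Nonempty := by
  obtain ⟨g, hg⟩ := interior_region_nonempty T
  refine ⟨g - v, fun l hl => ?_⟩
  have := mem_interior_region.1 hg l
  rw [coord_eq_add_slope T l v g, hl] at this
  linarith

/-- Along `w`, coordinates vanishing at `v` become positive at once, and positive ones stay so for
small `ε`. -/
lemma eventually_mem_interior {T : Triangle} {v w : Plane} (hv : v ∈ Triangle.region T)
    (hw : w ∈ innerCone T v) : ∀ᶠ ε : ℝ in 𝓝[>] 0, v + ε • w ∈ interior (Triangle.region T) := by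
  simp only [mem_interior_region]
  rw [eventually_all]
  intro l
  simp only [coord_add, map_smul, smul_eq_mul]
  rcases (mem_region.1 hv l).eq_or_lt with h | h
  · filter_upwards [self_mem_nhdsWithin] with ε hε
    rw [← h, zero_add]
    exact mul_pos hε (hw l h.symm)
  · have hc : Tendsto (fun ε : ℝ => coord T l v + ε * slope T l w) (𝓝[>] 0) (𝓝 (coord T l v)) := by
      have : Continuous fun ε : ℝ => coord T l v + ε * slope T l w := by fun_prop
      simpa using (this.tendsto 0).mono_left nhdsWithin_le_nhds
    exact hc.eventually_const_lt h

lemma innerCone_eq_univ {T : Triangle} {v : Plane} (hv : v ∈ interior (Triangle.region T)) :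
    innerCone T v = univ :=
  eq_univ_of_forall fun _ l hl => absurd hl (mem_interior_region.1 hv l).ne'

lemma mem_innerCone_of_openSide {T : Triangle} {v w : Plane} {k : Fin 3} (hv : v ∈ openSide T k)
    (hw : 0 < slope T k w) : w ∈ innerCone T v := by
  intro l hl
  rcases fin_three_cases k l with rfl | rfl | rfl
  · exact hw
  · exact absurd hl hv.2.1.ne'
  · exact absurd hl hv.2.2.ne'

lemma exists_slope_eq_one (T : Triangle) (k : Fin 3) : ∃ z, slope T k z = 1 := by
  refine ⟨T.points k - T.points (k + 1), ?_⟩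
  have := coord_eq_add_slope T k (T.points (k + 1)) (T.points k)
  rw [coord_points_self, coord_points_ne T ((by decide : ∀ k : Fin 3, k ≠ k + 1) k)] at this
  linarith

/-- Two linear functionals without a common positive point are opposite. -/
lemma exists_eq_neg_mul_of_disjoint {E : Type*} [AddCommGroup E] [Module ℝ E] {f g : E →ₗ[ℝ] ℝ}
    (hf : ∃ z, f z = 1) (hg : ∃ z, g z = 1) (h : ∀ w, 0 < f w → 0 < g w → False) :
    ∃ t > 0, ∀ w, g w = -(t * f w) := by
  obtain ⟨z, hz⟩ := hf
  obtain ⟨u, hu⟩ := hg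
  have h1 : ∀ y, f y = 0 → g y ≤ 0 := by
    intro y hy
    by_contra! hgy
    -- Moving from `z` along the kernel of `f` keeps `f = 1` and makes `g` positive.
    refine h (z + ((|g z| + 1) / g y) • y) (by simp [hy, hz]) ?_
    rw [map_add, map_smul, smul_eq_mul, div_mul_cancel₀ _ hgy.ne']
    linarith [neg_abs_le (g z)]
  have h2 : ∀ y, f y = 0 → g y = 0 := by
    intro y hy
    refine le_antisymm (h1 y hy) ?_
    have := h1 (-y) (by simp [hy])
    rw [map_neg] at this
    linarith
  have h3 : ∀ w, g w = g z * f w := by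
    intro w
    have := h2 (w - f w • z) (by simp [hz])
    rw [map_sub, map_smul, smul_eq_mul] at this
    linarith
  refine ⟨-g z, ?_, fun w => by rw [h3 w]; ring⟩
  have h4 : g z ≤ 0 := by
    by_contra! hgz
    exact h z (by linarith) hgz
  have h5 : g z ≠ 0 := by
    intro h0
    have := h3 u
    rw [h0, zero_mul] at this
    linarith
  have := lt_of_le_of_ne h4 h5
  linarith

/-- Two triangles that lie on opposite sides of a line carrying a side of each, with overlapping
sides of different length: an endpoint of one of the sides is inside the other. -/
lemma exists_points_mem_openSide {S S' : Triangle} {k l : Fin 3} {x : Plane}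
    (hx : x ∈ openSide S k) (hx' : x ∈ openSide S' l)
    {t : ℝ} (ht : 0 < t) (hs : ∀ w, slope S' l w = -(t * slope S k w))
    (hne : sideLength S k ≠ sideLength S' l) :
    (∃ n, S'.points n ∈ openSide S k) ∨ ∃ n, S.points n ∈ openSide S' l := by
  -- Proportional slopes and the common zero `x` force the two sides onto one line.
  have line : ∀ y, coord S' l y = 0 → coord S k y = 0 := by
    intro y hy
    have h1 := coord_eq_add_slope S' l x y
    have h2 := coord_eq_add_slope S k x y
    rw [hy, hx'.1, hs] at h1
    rw [hx.1] at h2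
    have : t * slope S k (y - x) = 0 := by linarith
    rcases mul_eq_zero.1 this with h | h <;> linarith
  have hkP := line _ (coord_points_ne S' ((by decide : ∀ k : Fin 3, k ≠ k + 1) l))
  have hkQ := line _ (coord_points_ne S' ((by decide : ∀ k : Fin 3, k ≠ k + 2) l))
  have hsP := coord_sum_cyclic S k (S'.points (l + 1))
  have hsQ := coord_sum_cyclic S k (S'.points (l + 2))
  have hsx := coord_sum_cyclic S k x
  have hsx' := coord_sum_cyclic S' l x
  have hcombo : ∀ a b : ℝ, a + b = 1 → ∀ (R : Triangle) (n : Fin 3),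
      coord R n (a • S'.points (l + 1) + b • S'.points (l + 2)) =
        a * coord R n (S'.points (l + 1)) + b * coord R n (S'.points (l + 2)) :=
    fun a b hab R n => Convex.combo_affine_apply hab
  have hτx : coord S (k + 1) x = coord S' (l + 1) x * coord S (k + 1) (S'.points (l + 1)) +
      coord S' (l + 2) x * coord S (k + 1) (S'.points (l + 2)) := by
    rw [← hcombo _ _ (by linarith [hx'.1]), ← eq_smul_add_smul_of_coord_eq_zero S' hx'.1]
  -- `coord S (k + 1)` is a parameter on this line: the side of `S` is `[0, 1]`, and that of `S'`
  -- has endpoints `p` and `q`.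
  have between : ∀ y, coord S k y = 0 →
      0 < (coord S (k + 1) (S'.points (l + 1)) - coord S (k + 1) y) *
        (coord S (k + 1) y - coord S (k + 1) (S'.points (l + 2))) → y ∈ openSide S' l := by
    intro y hy hpos
    have hsy := coord_sum_cyclic S k y
    set p := coord S (k + 1) (S'.points (l + 1))
    set q := coord S (k + 1) (S'.points (l + 2))
    set τ := coord S (k + 1) y with hτ
    have hpq : p - q ≠ 0 := by
      intro h0
      have : (p - τ) * (τ - q) = -(p - τ) ^ 2 := by
        have : q = p := by linarith
        rw [this]; ring
      nlinarith [sq_nonneg (p - τ)]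
    have hsq : 0 < (p - q) ^ 2 := by positivity
    have hθ : 0 < (τ - q) / (p - q) ∧ 0 < (p - τ) / (p - q) := by
      have e1 : (τ - q) / (p - q) = ((p - τ) * (τ - q) + (τ - q) ^ 2) / (p - q) ^ 2 := by
        field_simp; ring
      have e2 : (p - τ) / (p - q) = ((p - τ) * (τ - q) + (p - τ) ^ 2) / (p - q) ^ 2 := by
        field_simp; ring
      rw [e1, e2]
      constructor <;> positivity
    have hsum : (τ - q) / (p - q) + (p - τ) / (p - q) = 1 := by field_simp; ring
    have hy1 : coord S (k + 1) y =
        (τ - q) / (p - q) * p + (p - τ) / (p - q) * q := by rw [← hτ]; field_simp; ring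
    have hyeq : y = ((τ - q) / (p - q)) • S'.points (l + 1) +
        ((p - τ) / (p - q)) • S'.points (l + 2) := by
      have e0 : coord S k (((τ - q) / (p - q)) • S'.points (l + 1) +
        ((p - τ) / (p - q)) • S'.points (l + 2)) = 0 := by rw [hcombo _ _ hsum, hkP, hkQ]; ring
      have e1 : coord S (k + 1) (((τ - q) / (p - q)) • S'.points (l + 1) +
        ((p - τ) / (p - q)) • S'.points (l + 2)) = τ := by rw [hcombo _ _ hsum]; exact hy1.symm
      have es := coord_sum_cyclic S k (((τ - q) / (p - q)) • S'.points (l + 1) +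
        ((p - τ) / (p - q)) • S'.points (l + 2))
      refine eq_of_coord_eq S fun n => ?_
      rcases fin_three_cases k n with rfl | rfl | rfl
      · rw [hy, e0]
      · rw [e1]
      · linarith
    rw [hyeq]
    refine ⟨?_, ?_, ?_⟩ <;> rw [hcombo _ _ hsum]
    · rw [coord_points_ne S' ((by decide : ∀ k : Fin 3, k ≠ k + 1) l),
        coord_points_ne S' ((by decide : ∀ k : Fin 3, k ≠ k + 2) l)]; ring
    · rw [coord_points_self, coord_points_ne S' ((by decide : ∀ k : Fin 3, k + 1 ≠ k + 2) l)]
      linarith [hθ.1]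
    · rw [coord_points_self, coord_points_ne S' ((by decide : ∀ k : Fin 3, k + 2 ≠ k + 1) l)]
      linarith [hθ.2]
  by_contra! hcon
  obtain ⟨hA, hB⟩ := hcon
  have b1 := mt (between (S.points (k + 1))
    (coord_points_ne S ((by decide : ∀ k : Fin 3, k ≠ k + 1) k))) (hB _)
  have b2 := mt (between (S.points (k + 2))
    (coord_points_ne S ((by decide : ∀ k : Fin 3, k ≠ k + 2) k))) (hB _)
  rw [coord_points_self] at b1
  rw [coord_points_ne S ((by decide : ∀ k : Fin 3, k + 1 ≠ k + 2) k)] at b2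
  have a1 : ¬ (0 < coord S (k + 1) (S'.points (l + 1)) ∧ coord S (k + 1) (S'.points (l + 1)) < 1) :=
    fun h => hA (l + 1) ⟨hkP, h.1, by linarith [h.2]⟩
  have a2 : ¬ (0 < coord S (k + 1) (S'.points (l + 2)) ∧ coord S (k + 1) (S'.points (l + 2)) < 1) :=
    fun h => hA (l + 2) ⟨hkQ, h.1, by linarith [h.2]⟩
  have eqP : ∀ y, coord S k y = 0 → coord S (k + 1) y = 1 → y = S.points (k + 1) := by
    intro y h0 h1
    have := coord_sum_cyclic S k y
    refine eq_points_of_coord S ?_ ?_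
    · rw [add_assoc, show (1 + 1 : Fin 3) = 2 from rfl]; linarith
    · rwa [add_assoc, show (1 + 2 : Fin 3) = 0 from rfl, add_zero]
  have eqQ : ∀ y, coord S k y = 0 → coord S (k + 1) y = 0 → y = S.points (k + 2) := by
    intro y h0 h1
    refine eq_points_of_coord S ?_ ?_
    · rwa [add_assoc, show (2 + 1 : Fin 3) = 0 from rfl, add_zero]
    · rwa [add_assoc, show (2 + 2 : Fin 3) = 1 from rfl]
  have x0 := hx.2.1
  have x1 : coord S (k + 1) x < 1 := by linarith [hx.2.2, hx.1]
  obtain ⟨c0, c1, c2⟩ := hx'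
  -- Neither interval has an endpoint strictly inside the other, yet both contain the parameter of
  -- `x` inside, so they coincide.
  have hend : (coord S (k + 1) (S'.points (l + 1)) = 1 ∧ coord S (k + 1) (S'.points (l + 2)) = 0) ∨
      (coord S (k + 1) (S'.points (l + 1)) = 0 ∧ coord S (k + 1) (S'.points (l + 2)) = 1) := by
    clear between hcombo eqP eqQ line
    generalize coord S (k + 1) (S'.points (l + 1)) = p at *
    generalize coord S (k + 1) (S'.points (l + 2)) = q at *
    generalize coord S' (l + 1) x = a at *
    generalize coord S' (l + 2) x = b at *
    have hab : a + b = 1 := by linarith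
    obtain rfl : b = 1 - a := by linarith
    push Not at a1 a2 b1 b2
    rcases le_or_gt p 0 with hp | hp <;> rcases le_or_gt q 0 with hq | hq
    · nlinarith
    · have hq1 := a2 hq
      right
      constructor <;> nlinarith
    · have hp1 := a1 hp
      left
      constructor <;> nlinarith
    · nlinarith [a1 hp, a2 hq]
  rcases hend with ⟨hp, hq⟩ | ⟨hp, hq⟩
  · apply hne
    unfold sideLength
    rw [eqP _ hkP hp, eqQ _ hkQ hq]
  · apply hne
    unfold sideLength
    rw [eqQ _ hkP hp, eqP _ hkQ hq, dist_comm]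

/-! ### Tilings near a point -/

variable {ι : Type*} {T : ι → Triangle}

/-- A common inward direction would lead from `v` to a common interior point. -/
lemma IsTiling.innerCone_disjoint (hT : IsTiling T) {i j : ι} (hij : i ≠ j) {v w : Plane}
    (hi : v ∈ Triangle.region (T i)) (hj : v ∈ Triangle.region (T j))
    (hwi : w ∈ innerCone (T i) v) (hwj : w ∈ innerCone (T j) v) : False := by
  obtain ⟨ε, h1, h2⟩ := ((eventually_mem_interior hi hwi).and
    (eventually_mem_interior hj hwj)).exists
  exact disjoint_left.1 (hT.interiors_disjoint i j hij) h1 h2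

lemma IsTiling.notMem_interior (hT : IsTiling T) {i j : ι} (hij : i ≠ j) {v : Plane}
    (hi : v ∈ Triangle.region (T i)) : v ∉ interior (Triangle.region (T j)) := by
  intro hj
  obtain ⟨w, hw⟩ := innerCone_nonempty (T i) v
  exact hT.innerCone_disjoint hij hi (interior_subset hj) hw (innerCone_eq_univ hj ▸ mem_univ w)

/-- Inside a side, the inward directions contain an open half-plane. Two disjoint open half-planes
through the origin are opposite. -/
lemma IsTiling.slope_opposite (hT : IsTiling T) {i j : ι} (hij : i ≠ j) {k l : Fin 3} {v : Plane}
    (hi : v ∈ openSide (T i) k) (hj : v ∈ openSide (T j) l) :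
    ∃ t > 0, ∀ w, slope (T j) l w = -(t * slope (T i) k w) :=
  exists_eq_neg_mul_of_disjoint (exists_slope_eq_one _ _) (exists_slope_eq_one _ _) fun _ h1 h2 =>
    hT.innerCone_disjoint hij (openSide_subset_side _ _ hi).1 (openSide_subset_side _ _ hj).1
      (mem_innerCone_of_openSide hi h1) (mem_innerCone_of_openSide hj h2)

/-- A point inside sides of two tiles belongs to no third tile. -/
lemma IsTiling.notMem_third (hT : IsTiling T) {i j m : ι} (hij : i ≠ j) (hmi : m ≠ i)
    (hmj : m ≠ j) {k l : Fin 3} {v : Plane}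
    (hi : v ∈ openSide (T i) k) (hj : v ∈ openSide (T j) l) : v ∉ Triangle.region (T m) := by
  intro hm
  obtain ⟨t, ht, hs⟩ := hT.slope_opposite hij hi hj
  obtain ⟨w, hw⟩ := innerCone_nonempty (T m) v
  obtain ⟨z, hz⟩ := exists_slope_eq_one (T i) k
  -- An inward direction of the third tile points into `T j` or, after a small push along `z` within
  -- the open cone, into `T i`.
  rcases lt_or_ge (slope (T i) k w) 0 with h | h
  · refine hT.innerCone_disjoint hmj hm (openSide_subset_side _ _ hj).1 hw
      (mem_innerCone_of_openSide hj ?_)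
    rw [hs]
    nlinarith
  · have hc : Tendsto (fun ε : ℝ => w + ε • z) (𝓝[>] 0) (𝓝 w) := by
      have : Continuous fun ε : ℝ => w + ε • z := by fun_prop
      simpa using (this.tendsto 0).mono_left nhdsWithin_le_nhds
    obtain ⟨ε, h1, h2⟩ := ((hc.eventually ((isOpen_innerCone (T m) v).mem_nhds hw)).and
      self_mem_nhdsWithin).exists
    have h2 : 0 < ε := h2
    refine hT.innerCone_disjoint hmi hm (openSide_subset_side _ _ hi).1 h1
      (mem_innerCone_of_openSide hi ?_)
    rw [map_add, map_smul, hz, smul_eq_mul, mul_one]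
    linarith

/-! ### Counting tiles -/

/-- The indices of the tiles that meet the closed disc of radius `R` around the origin. -/
def meeting (T : ι → Triangle) (R : ℝ) : Set ι := {i | ∃ x ∈ Triangle.region (T i), ‖x‖ ≤ R}

lemma region_subset_closedBall {p R : ℝ} (hP : ∀ i, Triangle.perimeter (T i) = p) {i : ι}
    (hi : i ∈ meeting T R) : Triangle.region (T i) ⊆ closedBall 0 (R + p) := by
  obtain ⟨x, hx, hxR⟩ := hi
  intro y hy
  rw [mem_closedBall_zero_iff]
  have h1 := dist_le_perimeter hy hx
  rw [hP, dist_eq_norm] at h1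
  have h2 := norm_add_le (y - x) x
  rw [sub_add_cancel] at h2
  linarith

lemma meeting_add {p R : ℝ} (hP : ∀ i, Triangle.perimeter (T i) = p) {i j : ι} {x : Plane}
    (hi : i ∈ meeting T R) (hxi : x ∈ Triangle.region (T i)) (hxj : x ∈ Triangle.region (T j)) :
    j ∈ meeting T (R + p) :=
  ⟨x, hxj, mem_closedBall_zero_iff.1 (region_subset_closedBall hP hi hxi)⟩

lemma IsTiling.exists_mem (hT : IsTiling T) (x : Plane) : ∃ i, x ∈ Triangle.region (T i) :=
  mem_iUnion.1 (hT.covers ▸ mem_univ x)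

lemma IsTiling.card_mul_area_le (hT : IsTiling T) {A p R : ℝ}
    (hA : ∀ i, Triangle.area (T i) = A) (hP : ∀ i, Triangle.perimeter (T i) = p)
    (F : Finset ι) (hF : ∀ i ∈ F, i ∈ meeting T R) :
    F.card * A ≤ volume.real (closedBall (0 : Plane) (R + p)) := by
  have h1 : volume.real (⋃ i ∈ F, interior (Triangle.region (T i))) = F.card * A := by
    rw [measureReal_biUnion_finset (fun i _ j _ hij => hT.interiors_disjoint i j hij)
      (fun i _ => isOpen_interior.measurableSet) (fun i _ => by
        rw [volume_interior_region]; exact volume_region_ne_top _)]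
    rw [Finset.sum_congr rfl (fun i _ => show _ = A from ?_), Finset.sum_const, nsmul_eq_mul]
    rw [← hA i, measureReal_def, volume_interior_region]; rfl
  rw [← h1]
  refine measureReal_mono (iUnion₂_subset fun i hi => ?_) measure_closedBall_lt_top.ne
  exact interior_subset.trans (region_subset_closedBall hP (hF i hi))

/-- Local finiteness is not part of the definition of a tiling. It follows from packing disjoint
interiors of equal area into a disc. -/
lemma IsTiling.finite_meeting (hT : IsTiling T) {A p : ℝ}
    (hA : ∀ i, Triangle.area (T i) = A) (hP : ∀ i, Triangle.perimeter (T i) = p) (R : ℝ) :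
    (meeting T R).Finite := by
  obtain ⟨i₀, -⟩ := hT.exists_mem 0
  have hA0 : 0 < A := hA i₀ ▸ area_pos _
  by_contra hinf
  obtain ⟨n, hn⟩ := exists_nat_gt (volume.real (closedBall (0 : Plane) (R + p)) / A)
  obtain ⟨F, hF, rfl⟩ := Set.Infinite.exists_subset_card_eq hinf n
  have := hT.card_mul_area_le hA hP F fun i hi => hF hi
  rw [div_lt_iff₀ hA0] at hn
  linarith

lemma IsTiling.volume_le_card_mul_area (hT : IsTiling T) {A R : ℝ}
    (hA : ∀ i, Triangle.area (T i) = A) (F : Finset ι) (hF : ∀ i ∈ meeting T R, i ∈ F) :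
    volume.real (closedBall (0 : Plane) R) ≤ F.card * A := by
  have h1 : closedBall (0 : Plane) R ⊆ ⋃ i ∈ F, Triangle.region (T i) := by
    intro x hx
    obtain ⟨i, hi⟩ := hT.exists_mem x
    exact mem_biUnion (hF i ⟨x, hi, mem_closedBall_zero_iff.1 hx⟩) hi
  have h2 : volume (⋃ i ∈ F, Triangle.region (T i)) ≠ ⊤ :=
    (F.isCompact_biUnion fun i _ => isCompact_region (T i)).measure_lt_top.ne
  refine (measureReal_mono h1 h2).trans ((measureReal_biUnion_finset_le _ _).trans ?_)
  rw [Finset.sum_congr rfl (fun i _ => show volume.real (Triangle.region (T i)) = A from hA i),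
    Finset.sum_const, nsmul_eq_mul]

lemma volume_closedBall_eq {R : ℝ} (hR : 0 ≤ R) :
    volume.real (closedBall (0 : Plane) R) = R ^ 2 * volume.real (ball (0 : Plane) 1) := by
  rw [measureReal_def, Measure.addHaar_closedBall _ _ hR, ENNReal.toReal_mul, finrank_euclideanSpace,
    Fintype.card_fin, ENNReal.toReal_ofReal (by positivity)]
  rfl

/-- Only finitely many tiles come near `x`, and those missing `x` are closed, hence stay away from
it. -/
lemma IsTiling.eventually_mem_of_mem (hT : IsTiling T) {A p : ℝ}
    (hA : ∀ i, Triangle.area (T i) = A) (hP : ∀ i, Triangle.perimeter (T i) = p) (x : Plane) :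
    ∀ᶠ y in 𝓝 x, ∀ j, y ∈ Triangle.region (T j) → x ∈ Triangle.region (T j) := by
  have h1 : ∀ᶠ y in 𝓝 x, ∀ j ∈ meeting T (‖x‖ + 1),
      y ∈ Triangle.region (T j) → x ∈ Triangle.region (T j) := by
    rw [eventually_all_finite (hT.finite_meeting hA hP _)]
    intro j _
    by_cases hx : x ∈ Triangle.region (T j)
    · exact Eventually.of_forall fun _ _ => hx
    · filter_upwards [(isClosed_region (T j)).isOpen_compl.mem_nhds hx] with y hy h
      exact absurd h hy
  have h2 : ∀ᶠ y in 𝓝 x, ‖y‖ < ‖x‖ + 1 :=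
    continuous_norm.continuousAt.eventually_lt_const (lt_add_one _)
  filter_upwards [h1, h2] with y hy hn j hj
  exact hy j ⟨y, hj, hn.le⟩ hj

/-- A point inside a side that is not a vertex lies in a side that has a vertex of the tiling
inside. -/
lemma IsTiling.exists_side_through_vertex (hT : IsTiling T) {A p : ℝ}
    (hA : ∀ i, Triangle.area (T i) = A) (hP : ∀ i, Triangle.perimeter (T i) = p)
    (hne : ∀ i j, i ≠ j → ∀ k l, sideLength (T i) k ≠ sideLength (T j) l)
    {i : ι} {k : Fin 3} {x : Plane} (hx : x ∈ openSide (T i) k)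
    (hv : ∀ j l, x ≠ (T j).points l) :
    ∃ j l m n, (T m).points n ∈ openSide (T j) l ∧ x ∈ Triangle.region (T m) ∧
      x ∈ side (T j) l := by
  have hxi := (openSide_subset_side _ _ hx).1
  -- If `T i` were the only tile through `x`, it would be a neighbourhood of `x`.
  obtain ⟨j, hj, hji⟩ : ∃ j, x ∈ Triangle.region (T j) ∧ j ≠ i := by
    by_contra! hcon
    have hint : x ∈ interior (Triangle.region (T i)) := by
      rw [mem_interior_iff_mem_nhds]
      filter_upwards [hT.eventually_mem_of_mem hA hP x] with y hy
      obtain ⟨j, hj⟩ := hT.exists_mem y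
      exact hcon j (hy j hj) ▸ hj
    exact (mem_interior_region.1 hint k).ne' hx.1
  rcases region_cases hj with h | ⟨l, hl⟩ | ⟨l, hl⟩
  · exact absurd h (hT.notMem_interior hji.symm hxi)
  · obtain ⟨t, ht, hs⟩ := hT.slope_opposite hji.symm hx hl
    rcases exists_points_mem_openSide hx hl ht hs (hne i j hji.symm k l) with ⟨n, hn⟩ | ⟨n, hn⟩
    · exact ⟨i, k, j, n, hn, hj, openSide_subset_side _ _ hx⟩
    · exact ⟨j, l, i, n, hn, hxi, openSide_subset_side _ _ hl⟩
  · exact absurd hl (hv j l)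

/-- The side having a given vertex of the tiling inside is unique. -/
lemma IsTiling.openSide_eq_of_vertex (hT : IsTiling T) {i j m : ι} {k l n : Fin 3}
    (hi : (T m).points n ∈ openSide (T i) k) (hj : (T m).points n ∈ openSide (T j) l) :
    (i, k) = (j, l) := by
  by_cases hij : i = j
  · subst hij
    rw [openSide_unique hi hj]
  · exfalso
    -- `T m` is a third tile, since no vertex lies inside a side of its own triangle.
    refine hT.notMem_third (m := m) hij ?_ ?_ hi hj (points_mem_region _ _)
    · rintro rfl; exact points_notMem_openSide _ _ _ hi
    · rintro rfl; exact points_notMem_openSide _ _ _ hj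

/-! ### Angles -/

/-- The open sector of radius `r` that the triangle spans at its vertex `k`, moved to the origin. -/
def sector (T : Triangle) (k : Fin 3) (r : ℝ) : Set Plane :=
  {w ∈ ball 0 r | 0 < slope T (k + 1) w ∧ 0 < slope T (k + 2) w}

lemma isOpen_sector (T : Triangle) (k : Fin 3) (r : ℝ) : IsOpen (sector T k r) :=
  isOpen_ball.inter ((isOpen_lt continuous_const (continuous_slope T _)).inter
    (isOpen_lt continuous_const (continuous_slope T _)))

/-- `U` and `-U` are disjoint and of equal volume. Angles are measured by volumes of sectors, a
straight angle being half a disc. -/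
lemma two_mul_volume_le_of_disjoint_neg {U : Set Plane} {r : ℝ} (hU : MeasurableSet U)
    (hUr : U ⊆ ball 0 r) (hd : ∀ w ∈ U, -w ∉ U) : 2 * volume U ≤ volume (ball (0 : Plane) r) := by
  have h1 : volume (Neg.neg ⁻¹' U) = volume U := Measure.measure_preimage_neg volume U
  have h2 : volume (U ∪ Neg.neg ⁻¹' U) = volume U + volume (Neg.neg ⁻¹' U) :=
    measure_union (disjoint_left.2 hd) (measurable_neg hU)
  rw [two_mul]
  nth_rewrite 2 [← h1]
  rw [← h2]
  refine measure_mono (union_subset hUr fun w hw => ?_)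
  simpa using hUr hw

/-- The three angles of a triangle add up to at most a straight angle. -/
lemma two_mul_sum_volume_sector_le (T : Triangle) (r : ℝ) :
    2 * ∑ k, volume (sector T k r) ≤ volume (ball (0 : Plane) r) := by
  -- The slopes sum to zero, so sector `k` has sign `-` at `k` and `+` elsewhere. These patterns
  -- exclude each other and each other's negatives.
  have neg : ∀ k w, w ∈ sector T k r → slope T k w < 0 ∧ 0 < slope T (k + 1) w ∧
      0 < slope T (k + 2) w := by
    rintro k w ⟨-, h1, h2⟩
    exact ⟨by linarith [slope_sum_cyclic T k w], h1, h2⟩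
  have hd : Set.PairwiseDisjoint (↑(Finset.univ : Finset (Fin 3))) fun k => sector T k r := by
    intro k _ l _ hkl
    refine disjoint_left.2 fun w hk hl => ?_
    rcases fin_three_cases k l with rfl | rfl | rfl
    · exact hkl rfl
    · linarith [(neg _ w hk).2.1, (neg _ w hl).1]
    · linarith [(neg _ w hk).2.2, (neg _ w hl).1]
  rw [← measure_biUnion_finset hd fun k _ => (isOpen_sector T k r).measurableSet]
  refine two_mul_volume_le_of_disjoint_neg (Finset.measurableSet_biUnion _ fun k _ =>
    (isOpen_sector T k r).measurableSet) (iUnion₂_subset fun k _ => fun w hw => hw.1) ?_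
  intro w hw hw'
  simp only [Finset.mem_univ, iUnion_true, mem_iUnion] at hw hw'
  obtain ⟨k, hk⟩ := hw
  obtain ⟨l, hl⟩ := hw'
  have h1 := neg k w hk
  have h2 := neg l (-w) hl
  simp only [map_neg] at h2
  rcases fin_three_cases k l with rfl | rfl | rfl
  · linarith
  · rw [add_assoc, show (1 + 1 : Fin 3) = 2 from rfl] at h2
    linarith
  · rw [add_assoc k 2 2, show (2 + 2 : Fin 3) = 1 from rfl] at h2
    linarith

open Classical in
/-- At a vertex inside a side, the angles of the tiles with this vertex add up to at least a
straight angle. -/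
lemma IsTiling.eventually_volume_ball_le (hT : IsTiling T) {A p : ℝ}
    (hA : ∀ i, Triangle.area (T i) = A) (hP : ∀ i, Triangle.perimeter (T i) = p)
    {i m : ι} {k n : Fin 3} {v : Plane} (hvi : v ∈ openSide (T i) k) (hvm : v = (T m).points n)
    (F : Finset ι) (hF : ∀ j, v ∈ Triangle.region (T j) → j ∈ F) :
    ∀ᶠ r in 𝓝[>] (0 : ℝ), volume (ball (0 : Plane) r) ≤
      2 * ∑ j ∈ F, ∑ l, if (T j).points l = v then volume (sector (T j) l r) else 0 := by
  obtain ⟨ε, hε, hball⟩ := Metric.eventually_nhds_iff_ball.1 (hT.eventually_mem_of_mem hA hP v)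
  filter_upwards [Ioo_mem_nhdsGT hε] with r hr
  set B := volume (ball (0 : Plane) r) with hB
  have hBtop : B ≠ ⊤ := measure_ball_lt_top.ne
  let h : ι → ENNReal := fun j => volume (interior (Triangle.region (T j)) ∩ ball v r)
  have hpre : ∀ j, h j = volume {w ∈ ball (0 : Plane) r | v + w ∈
      interior (Triangle.region (T j))} := by
    intro j
    change volume (interior (Triangle.region (T j)) ∩ ball v r) = _
    rw [← measure_preimage_add volume v]
    congr 1
    ext w
    simp [and_comm]
  have hcov : B ≤ ∑ j ∈ F with v ∈ Triangle.region (T j), h j := by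
    have e1 : B = volume (ball v r) := (Measure.addHaar_ball_center volume v r).symm
    have e2 : ball v r ⊆ ⋃ j ∈ F.filter fun j => v ∈ Triangle.region (T j),
        (Triangle.region (T j) ∩ ball v r) := by
      intro y hy
      obtain ⟨j, hj⟩ := hT.exists_mem y
      have hvj := hball y (ball_subset_ball hr.2.le hy) j hj
      exact mem_biUnion (Finset.mem_filter.2 ⟨hF j hvj, hvj⟩) ⟨hj, hy⟩
    rw [e1]
    refine (measure_mono e2).trans ((measure_biUnion_finset_le _ _).trans ?_)
    refine Finset.sum_le_sum fun j _ => (measure_congr ?_).le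
    have : interior (Triangle.region (T j)) =ᵐ[volume] Triangle.region (T j) :=
      interior_ae_eq_of_null_frontier ((convex_region (T j)).addHaar_frontier _)
    exact (this.inter (ae_eq_refl _)).symm
  -- The tile with `v` inside its side stays in one half-plane.
  have hi : 2 * h i ≤ B := by
    refine le_trans ?_ (two_mul_volume_le_of_disjoint_neg
      (U := {w ∈ ball (0 : Plane) r | 0 < slope (T i) k w})
      (isOpen_ball.inter (isOpen_lt continuous_const (continuous_slope _ _))).measurableSet
      (fun w hw => hw.1) ?_)
    · rw [hpre]
      gcongr 2 * volume ?_
      rintro w ⟨hw, hwi⟩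
      refine ⟨hw, ?_⟩
      have := mem_interior_region.1 hwi k
      rwa [coord_add, hvi.1, zero_add] at this
    · rintro w ⟨-, h1⟩ ⟨-, h2⟩
      rw [map_neg] at h2
      linarith
  -- Any other tile through `v` has a corner there, because `v` is inside only one side.
  have hj : ∀ j ∈ F.filter fun j => v ∈ Triangle.region (T j), j ≠ i →
      h j ≤ ∑ l, if (T j).points l = v then volume (sector (T j) l r) else 0 := by
    intro j hj hji
    have hvj := (Finset.mem_filter.1 hj).2
    rcases region_cases hvj with h0 | ⟨l, hl⟩ | ⟨l, hl⟩
    · exact absurd h0 (hT.notMem_interior hji.symm (openSide_subset_side _ _ hvi).1)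
    · subst hvm
      exact absurd (congrArg Prod.fst (hT.openSide_eq_of_vertex hl hvi)) hji
    · refine le_trans ?_ (Finset.single_le_sum (fun _ _ => zero_le) (Finset.mem_univ l))
      rw [if_pos hl.symm, hpre]
      refine measure_mono ?_
      rintro w ⟨hw, hwi⟩
      have hw' := mem_interior_region.1 hwi
      simp only [coord_add, hl] at hw'
      refine ⟨hw, ?_, ?_⟩
      · have := hw' (l + 1)
        rwa [coord_points_ne _ ((by decide : ∀ k : Fin 3, k + 1 ≠ k) l), zero_add] at this
      · have := hw' (l + 2)
        rwa [coord_points_ne _ ((by decide : ∀ k : Fin 3, k + 2 ≠ k) l), zero_add] at this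
  set X := ∑ j ∈ F, ∑ l, if (T j).points l = v then volume (sector (T j) l r) else 0 with hX
  have hle : B ≤ h i + X := by
    have hiF : i ∈ F.filter fun j => v ∈ Triangle.region (T j) :=
      Finset.mem_filter.2 ⟨hF i (openSide_subset_side _ _ hvi).1, (openSide_subset_side _ _ hvi).1⟩
    refine hcov.trans ?_
    rw [← Finset.add_sum_erase _ _ hiF]
    gcongr
    refine (Finset.sum_le_sum fun j hjm => hj j (Finset.mem_of_mem_erase hjm)
      (Finset.ne_of_mem_erase hjm)).trans ?_
    exact Finset.sum_le_sum_of_subset ((Finset.erase_subset _ _).trans (Finset.filter_subset _ _))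
  have : B + B ≤ B + 2 * X := by
    calc B + B = 2 * B := (two_mul _).symm
      _ ≤ 2 * (h i + X) := by gcongr
      _ = 2 * h i + 2 * X := mul_add _ _ _
      _ ≤ B + 2 * X := by gcongr
  exact (ENNReal.add_le_add_iff_left hBtop).1 this

/-! ### Double counting -/

/-- `v` is a vertex of the tiling that lies inside a side. -/
def IsSideVertex (T : ι → Triangle) (v : Plane) : Prop :=
  (∃ m n, v = (T m).points n) ∧ ∃ j l, v ∈ openSide (T j) l

/-- There are at most as many vertices inside sides as tiles. -/
lemma IsTiling.card_sideVertex_le (hT : IsTiling T) {A p R : ℝ}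
    (hA : ∀ i, Triangle.area (T i) = A) (hP : ∀ i, Triangle.perimeter (T i) = p)
    (V : Finset Plane) (hV : ∀ v ∈ V, IsSideVertex T v ∧ ‖v‖ ≤ R)
    (F : Finset ι) (hF : ∀ i ∈ meeting T R, i ∈ F) : V.card ≤ F.card := by
  classical
  -- Finiteness of `V` gives one radius that serves all its vertices.
  have hev : ∀ᶠ r in 𝓝[>] (0 : ℝ), ∀ v ∈ V, volume (ball (0 : Plane) r) ≤
      2 * ∑ j ∈ F, ∑ l, if (T j).points l = v then volume (sector (T j) l r) else 0 := by
    rw [eventually_all_finset]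
    intro v hv
    obtain ⟨⟨⟨m, n, hmn⟩, j, l, hjl⟩, hvR⟩ := hV v hv
    exact hT.eventually_volume_ball_le hA hP hjl hmn F fun j hj => hF j ⟨v, hj, hvR⟩
  obtain ⟨r, hr, hr0⟩ := (hev.and self_mem_nhdsWithin).exists
  have hr0 : 0 < r := hr0
  have hB0 : volume (ball (0 : Plane) r) ≠ 0 := (measure_ball_pos _ _ hr0).ne'
  have hBt : volume (ball (0 : Plane) r) ≠ ⊤ := measure_ball_lt_top.ne
  have key : (V.card : ENNReal) * volume (ball (0 : Plane) r) ≤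
      F.card * volume (ball (0 : Plane) r) := by
    calc (V.card : ENNReal) * volume (ball (0 : Plane) r)
        = ∑ v ∈ V, volume (ball (0 : Plane) r) := by rw [Finset.sum_const, nsmul_eq_mul]
      _ ≤ ∑ v ∈ V, 2 * ∑ j ∈ F, ∑ l,
          if (T j).points l = v then volume (sector (T j) l r) else 0 := Finset.sum_le_sum hr
      _ = ∑ j ∈ F, 2 * ∑ l, ∑ v ∈ V,
          if (T j).points l = v then volume (sector (T j) l r) else 0 := by
        rw [← Finset.mul_sum, Finset.sum_comm, Finset.mul_sum]
        exact Finset.sum_congr rfl fun j _ => by rw [Finset.sum_comm]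
      -- A corner of a tile is charged by at most one `v`.
      _ ≤ ∑ j ∈ F, 2 * ∑ l, volume (sector (T j) l r) := by
        gcongr with j _ l _
        rw [Finset.sum_ite_eq]
        split_ifs <;> simp
      _ ≤ ∑ j ∈ F, volume (ball (0 : Plane) r) :=
        Finset.sum_le_sum fun j _ => two_mul_sum_volume_sector_le (T j) r
      _ = F.card * volume (ball (0 : Plane) r) := by rw [Finset.sum_const, nsmul_eq_mul]
  exact_mod_cast (ENNReal.mul_le_mul_iff_left hB0 hBt).1 key

/-- Off the vertices, every point lies in at most two sides. -/
lemma IsTiling.card_sides_le_two (hT : IsTiling T) {x : Plane} (hv : ∀ j l, x ≠ (T j).points l)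
    (Q : Finset (ι × Fin 3)) (hQ : ∀ q ∈ Q, x ∈ side (T q.1) q.2) : Q.card ≤ 2 := by
  by_contra! hcard
  obtain ⟨a, b, c, ha, hb, hc, hab, hac, hbc⟩ := Finset.two_lt_card_iff.1 hcard
  have hos : ∀ q ∈ Q, x ∈ openSide (T q.1) q.2 := fun q hq =>
    mem_openSide_of_mem_side (hQ q hq) (hv _)
  have hne : ∀ q ∈ Q, ∀ q' ∈ Q, q ≠ q' → q.1 ≠ q'.1 := by
    rintro ⟨i, k⟩ hq ⟨j, l⟩ hq' hne rfl
    have h1 := hos _ hq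
    have h2 := hos _ hq'
    exact hne (Prod.ext rfl (openSide_unique h2 h1))
  exact hT.notMem_third (hne a ha b hb hab) (hne c hc a ha hac.symm) (hne c hc b hb hbc.symm)
    (hos a ha) (hos b hb) (hQ c hc).1

/-- The total perimeter of the tiles near a disc is controlled by the number of tiles near a
slightly larger disc. -/
lemma IsTiling.card_mul_perimeter_le (hT : IsTiling T) {A p d R : ℝ}
    (hA : ∀ i, Triangle.area (T i) = A) (hP : ∀ i, Triangle.perimeter (T i) = p)
    (hne : ∀ i j, i ≠ j → ∀ k l, sideLength (T i) k ≠ sideLength (T j) l)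
    (hd0 : 0 ≤ d) (hd : ∀ i k, sideLength (T i) k ≤ d)
    (F G : Finset ι) (hF : ∀ i ∈ F, i ∈ meeting T R)
    (hG : ∀ i ∈ meeting T (R + p + p), i ∈ G) : F.card * p ≤ 2 * (G.card * d) := by
  classical
  let m : Measure Plane := Measure.hausdorffMeasure 1
  have hfin := hT.finite_meeting hA hP (R + p)
  -- A tile touching a tile of `F` meets the disc of radius `R + p`, so its vertices have norm at
  -- most `R + p + p`; this explains the radius for `G`.
  let N : Finset Plane := (hfin.toFinset ×ˢ Finset.univ).image fun q : ι × Fin 3 => (T q.1).points q.2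
  let V : Finset Plane := N.filter (IsSideVertex T)
  have hVG : V.card ≤ G.card := by
    refine hT.card_sideVertex_le hA hP V (fun v hv => ?_) G hG
    obtain ⟨hvN, hvs⟩ := Finset.mem_filter.1 hv
    refine ⟨hvs, ?_⟩
    obtain ⟨q, hq, rfl⟩ := Finset.mem_image.1 hvN
    have hq1 := hfin.mem_toFinset.1 (Finset.mem_product.1 hq).1
    exact mem_closedBall_zero_iff.1 (region_subset_closedBall hP hq1 (points_mem_region _ _))
  have hE : ∀ v ∈ V, ∃ q : ι × Fin 3, v ∈ openSide (T q.1) q.2 := by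
    intro v hv
    obtain ⟨-, j, l, h⟩ := (Finset.mem_filter.1 hv).2
    exact ⟨(j, l), h⟩
  have : Nonempty (ι × Fin 3) := ⟨(hT.exists_mem 0).choose, 0⟩
  choose! E hE using hE
  let U : Set Plane := ⋃ v ∈ V, side (T (E v).1) (E v).2
  let Q : Finset (ι × Fin 3) := F ×ˢ Finset.univ
  -- Off `N`, a point is on at most two sides, and if on any, then on a selected side `E v`.
  have hpt : ∀ x, x ∉ N → ∑ q ∈ Q, (side (T q.1) q.2).indicator (1 : Plane → ENNReal) x ≤
      2 * U.indicator (1 : Plane → ENNReal) x := by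
    intro x hx
    have hsum : ∑ q ∈ Q, (side (T q.1) q.2).indicator (1 : Plane → ENNReal) x =
        (Q.filter fun q => x ∈ side (T q.1) q.2).card := by
      simp only [Set.indicator_apply, Pi.one_apply, Finset.sum_boole]
    rw [hsum]
    rcases (Q.filter fun q => x ∈ side (T q.1) q.2).eq_empty_or_nonempty with h0 | ⟨q, hq⟩
    · simp [h0]
    obtain ⟨hqQ, hqx⟩ := Finset.mem_filter.1 hq
    have hqF : q.1 ∈ meeting T R := hF _ (Finset.mem_product.1 hqQ).1
    have hmem : ∀ j, x ∈ Triangle.region (T j) → j ∈ hfin.toFinset := fun j hj =>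
      hfin.mem_toFinset.2 (meeting_add hP hqF hqx.1 hj)
    have hv : ∀ j l, x ≠ (T j).points l := by
      rintro j l rfl
      exact hx (Finset.mem_image.2
        ⟨(j, l), Finset.mem_product.2 ⟨hmem j (points_mem_region _ _), Finset.mem_univ _⟩, rfl⟩)
    have hxU : x ∈ U := by
      obtain ⟨j, l, a, n, h1, h2, h3⟩ := hT.exists_side_through_vertex hA hP hne
        (mem_openSide_of_mem_side hqx (hv _)) hv
      have hVm : (T a).points n ∈ V := Finset.mem_filter.2 ⟨Finset.mem_image.2
        ⟨(a, n), Finset.mem_product.2 ⟨hmem a h2, Finset.mem_univ _⟩, rfl⟩, ⟨a, n, rfl⟩, j, l, h1⟩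
      -- By uniqueness, the selected side is the one through `x`.
      have hEq : (j, l) = E ((T a).points n) := hT.openSide_eq_of_vertex h1 (hE _ hVm)
      refine mem_biUnion hVm ?_
      rw [← hEq]
      exact h3
    rw [Set.indicator_of_mem hxU, Pi.one_apply, mul_one]
    exact_mod_cast hT.card_sides_le_two hv _ fun q hq => (Finset.mem_filter.1 hq).2
  have hUm : MeasurableSet U := Finset.measurableSet_biUnion _ fun v _ => measurableSet_side _ _
  have hmain : ∑ q ∈ Q, m (side (T q.1) q.2) ≤ 2 * m U := by
    have e1 : ∑ q ∈ Q, m (side (T q.1) q.2) =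
        ∫⁻ x, ∑ q ∈ Q, (side (T q.1) q.2).indicator (1 : Plane → ENNReal) x ∂m := by
      rw [lintegral_finsetSum _ fun q _ => measurable_one.indicator (measurableSet_side _ _)]
      exact Finset.sum_congr rfl fun q _ => (lintegral_indicator_one (measurableSet_side _ _)).symm
    have e2 : ∫⁻ x, 2 * U.indicator (1 : Plane → ENNReal) x ∂m = 2 * m U := by
      rw [lintegral_const_mul _ (measurable_one.indicator hUm), lintegral_indicator_one hUm]
    rw [e1, ← e2]
    refine lintegral_mono_ae ?_
    -- One-dimensional Hausdorff measure has no atoms, so the finite set `N` can be ignored.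
    have hN : m (N : Set Plane) = 0 := by
      have := Measure.nullSingletonClass_hausdorff Plane (d := 1) one_pos
      exact N.finite_toSet.measure_zero m
    have : ∀ᵐ x ∂m, x ∉ (N : Set Plane) := measure_eq_zero_iff_ae_notMem.1 hN
    filter_upwards [this] with x hx
    exact hpt x hx
  have hleft : ∑ q ∈ Q, m (side (T q.1) q.2) = ENNReal.ofReal (F.card * p) := by
    have hp : ∀ i, ∑ k, m (side (T i) k) = ENNReal.ofReal p := by
      intro i
      simp only [m, hausdorffMeasure_side]
      rw [← ENNReal.ofReal_sum_of_nonneg fun k _ => (sideLength_pos _ _).le, ← hP i,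
        perimeter_eq (T i) 0, Fin.sum_univ_three]
      rfl
    rw [Finset.sum_product, Finset.sum_congr rfl fun i _ => hp i, Finset.sum_const, nsmul_eq_mul,
      ENNReal.ofReal_mul (by positivity), ENNReal.ofReal_natCast]
  have hright : m U ≤ ENNReal.ofReal (V.card * d) := by
    refine (measure_biUnion_finset_le _ _).trans ?_
    rw [ENNReal.ofReal_mul (by positivity), ENNReal.ofReal_natCast, ← nsmul_eq_mul]
    refine Finset.sum_le_card_nsmul _ _ _ fun v _ => ?_
    simp only [m, hausdorffMeasure_side]
    exact ENNReal.ofReal_le_ofReal (hd _ _)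
  have hfinal : ENNReal.ofReal (F.card * p) ≤ ENNReal.ofReal (2 * (V.card * d)) := by
    rw [← hleft, ENNReal.ofReal_mul (by norm_num), ENNReal.ofReal_ofNat]
    exact hmain.trans (by gcongr)
  have h1 := (ENNReal.ofReal_le_ofReal_iff (by positivity)).1 hfinal
  have h2 : (V.card : ℝ) * d ≤ G.card * d :=
    mul_le_mul_of_nonneg_right (by exact_mod_cast hVG) hd0
  linarith

end TriangleTiling

/-! ### Comparison of disc areas and the contradiction -/

theorem theorem2 :
    ¬ ∃ (ι : Type*) (T : ι → TriangleTiling.Triangle),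
      TriangleTiling.IsTiling T ∧
      (∀ i j, i ≠ j → ¬ TriangleTiling.Triangle.IsCongruent (T i) (T j)) ∧
      (∀ i j, TriangleTiling.Triangle.area (T i) = TriangleTiling.Triangle.area (T j)) ∧
      (∀ i j, TriangleTiling.Triangle.perimeter (T i) =
        TriangleTiling.Triangle.perimeter (T j)) := by
  open TriangleTiling in
  rintro ⟨ι, T, hT, hC, hA, hP⟩
  obtain ⟨i₀, -⟩ := hT.exists_mem 0
  have hne : ∀ i j, i ≠ j → ∀ k l, sideLength (T i) k ≠ sideLength (T j) l :=
    fun i j hij k l h => hC i j hij (isCongruent_of_common_sideLength (hA i j) (hP i j) h)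
  have hA' := fun i => hA i i₀
  have hP' := fun i => hP i i₀
  set A := Triangle.area (T i₀)
  set p := Triangle.perimeter (T i₀) with hp
  have hA0 : 0 < A := area_pos _
  have hp0 : 0 < p := (sideLength_pos (T i₀) 0).trans_le (sideLength_le_perimeter _ _)
  set e := 2 * cross (T i₀) ^ 2 / p ^ 3 with he
  have he0 : 0 < e := div_pos (mul_pos two_pos (cross_sq_pos _)) (by positivity)
  have hd : ∀ i k, sideLength (T i) k ≤ p / 2 - e := by
    intro i k
    have := sideLength_le (T i) k
    rwa [hP' i, cross_sq_eq_of_area_eq (hA i i₀)] at this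
  have hd0 : 0 ≤ p / 2 - e := (sideLength_pos (T i₀) 0).le.trans (hd i₀ 0)
  -- The radius is `x * p`. Of the three extra layers of width `p`, two come from the perimeter
  -- count and one from packing.
  have hgrowth : ∀ x : ℝ, 0 ≤ x → x ^ 2 * p ≤ (x + 3) ^ 2 * (p - 2 * e) := by
    intro x hx
    have hf := hT.finite_meeting hA' hP' (x * p)
    have hg := hT.finite_meeting hA' hP' (x * p + p + p)
    have h1 := hT.card_mul_perimeter_le hA' hP' hne hd0 hd hf.toFinset hg.toFinset
      (fun i hi => hf.mem_toFinset.1 hi) (fun i hi => hg.mem_toFinset.2 hi)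
    have h2 := hT.volume_le_card_mul_area hA' hf.toFinset (fun i hi => hf.mem_toFinset.2 hi)
    have h3 := hT.card_mul_area_le hA' hP' hg.toFinset (fun i hi => hg.mem_toFinset.1 hi)
    rw [volume_closedBall_eq (by positivity)] at h2 h3
    set c := MeasureTheory.volume.real (Metric.ball (0 : Plane) 1)
    have hc : 0 < c := ENNReal.toReal_pos (Metric.measure_ball_pos _ _ one_pos).ne'
      MeasureTheory.measure_ball_lt_top.ne
    have h4 : (x * p) ^ 2 * c * p ≤ (x * p + p + p + p) ^ 2 * c * (p - 2 * e) := by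
      calc (x * p) ^ 2 * c * p ≤ hf.toFinset.card * A * p :=
            mul_le_mul_of_nonneg_right h2 hp0.le
        _ = A * (hf.toFinset.card * p) := by ring
        _ ≤ A * (2 * (hg.toFinset.card * (p / 2 - e))) := mul_le_mul_of_nonneg_left h1 hA0.le
        _ = hg.toFinset.card * A * (p - 2 * e) := by ring
        _ ≤ _ := mul_le_mul_of_nonneg_right h3 (by linarith)
    have h5 : p ^ 2 * c * (x ^ 2 * p) ≤ p ^ 2 * c * ((x + 3) ^ 2 * (p - 2 * e)) := by
      calc p ^ 2 * c * (x ^ 2 * p) = (x * p) ^ 2 * c * p := by ring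
        _ ≤ _ := h4
        _ = _ := by ring
    exact le_of_mul_le_mul_left h5 (by positivity)
  -- Growth gives `2 * x ^ 2 * e ≤ (6 * x + 9) * p ≤ 15 * x * p` for `x ≥ 1`, which fails once `x *
  -- e > 15 * p`.
  have h := hgrowth (15 * p / e + 1) (by positivity)
  have hx : (15 * p / e + 1) * e = 15 * p + e := by field_simp
  have hx1 : 1 ≤ 15 * p / e + 1 := by
    have : 0 ≤ 15 * p / e := by positivity
    linarith
  generalize 15 * p / e + 1 = x at *
  have h6 : 2 * (x * (x * e)) ≤ (6 * x + 9) * p := by nlinarith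
  rw [hx] at h6
  nlinarith [mul_pos (by linarith : 0 < x) he0]
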